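/- Let $m, m_{12} \ge 1$ be integers and put $n = m_{12}m$. The tensor network variety of the triangle with vertices $0,1,2$, bond dimensions $(m_{01},m_{12},m_{02}) = (m,m_{12},m)$ and physical dimensions $(2,n,n)$ is the Zariski closure $\mathcal{T} \subseteq \mathbb{C}^2\otimes\mathbb{C}^n\otimes\mathbb{C}^n$ of the set of all tensors $(X_0\otimes X_1\otimes X_2)\,T(\Delta)$, where $T(\Delta)=\sum_{i,k=1}^{m}\sum_{j=1}^{m_{12}} (e_i\otimes e_k)\otimes(e_i\otimes e_j)\otimes(e_j\otimes e_k)$ is the graph tensor and $X_0:\mathbb{C}^m\otimes\mathbb{C}^m\to\mathbb{C}^2$, $X_1:\mathbb{C}^m\otimes\mathbb{C}^{m_{12}}\to\mathbb{C}^n$, $X_2:\mathbb{C}^{m_{12}}\otimes\mathbb{C}^m\to\mathbb{C}^n$ are arbitrary linear maps. Regard elements of $\mathbb{C}^2\otimes\mathbb{C}^n\otimes\mathbb{C}^n$ as $n\times n$ matrices with entries in $\mathbb{C}^2$ (pencils). For $z\in\mathbb{C}^2$ let $J_1(z)$ be the $1\times 1$ pencil $(z)$; let $\boxplus$ denote the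 block-diagonal sum and $J_1(z)\boxtimes \mathbf{I}_{q}$ the $q\times q$ diagonal pencil $z\cdot \mathbf{I}_q$. Theorem. (1) A generic element of $\mathcal{T}$ is, after a change of coordinates in the second and third tensor factors, of the form $\boxplus_{i=1}^m \bigl(J_1(z_i)\boxtimes \mathbf{I}_{m_{12}}\bigr)$ with $(z_1,\dots,z_m)\in(\mathbb{C}^2)^m$ generic. That is, for every non-empty Zariski open $\Omega\subseteq(\mathbb{C}^2)^m$ there is a Zariski open dense subset of $\mathcal{T}$ all of whose elements have this form with $(z_1,\dots,z_m)\in\Omega$; and conversely every tensor of this form, for any $z_1,\dots,z_m\in\mathbb{C}^2$, lies in $\mathcal{T}$. (2) The (affine) dimension of $\mathcal{T}$ is \[ \dim \mathcal{T} = (2m-1)\,m\,m_{12}^2+m . \] (3) Consider the parameter count $p=\sum_{i}\bigl(n_i\prod_{e\ni i}m_e-1\bigr)-\sum_{e}(m_e^2-1)+1$ of the network, where $i$ runs over the vertices, $e$ over the edges, $n_i$ are the physical and $m_e$ the bond dimensions. Then both the defect $\min\{p,\,2n^2\}-\dim\mathcal{T}$ and the fiber defect $p-\dim\mathcal{T}$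 are equal to $(m-1)(m_{12}^2-1)$. -/

import Mathlib

open scoped Kronecker

noncomputable section

namespace TensorNetwork

/-! ### Complex affine varieties -/

/-- The Zariski closure of a set of points of the affine space `ℂ^σ`. -/
def zariskiClosure {σ : Type} (S : Set (σ → ℂ)) : Set (σ → ℂ) :=
  MvPolynomial.zeroLocus ℂ (MvPolynomial.vanishingIdeal ℂ S)

/-- A set of points of `ℂ^σ` is Zariski open if its complement is the common zero set of a
set of polynomials. -/
def IsZariskiOpen {σ : Type} (U : Set (σ → ℂ)) : Prop :=
  ∃ I : Ideal (MvPolynomial σ ℂ), Uᶜ = MvPolynomial.zeroLocus ℂ I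

/-- The dimension of an affine variety `X ⊆ ℂ^σ`: the Krull dimension of its coordinate ring
`ℂ[x_s : s ∈ σ] / I(X)`. -/
def affineDim {σ : Type} (X : Set (σ → ℂ)) : WithBot ℕ∞ :=
  ringKrullDim (MvPolynomial σ ℂ ⧸ MvPolynomial.vanishingIdeal ℂ X)

/-- The dimension as an integer, for a non-empty variety in a finite-dimensional space. -/
def affineDimInt {σ : Type} (X : Set (σ → ℂ)) : ℤ :=
  (((affineDim X).unbotD 0).toNat : ℤ)

/-- A property holds for the generic element of the variety `X` if it holds for all points of
a Zariski open and Zariski dense subset of `X`. -/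
def HoldsGenerically {σ : Type} (X : Set (σ → ℂ)) (P : (σ → ℂ) → Prop) : Prop :=
  ∃ U : Set (σ → ℂ), IsZariskiOpen U ∧ X ⊆ zariskiClosure (X ∩ U) ∧ ∀ T ∈ X ∩ U, P T

/-! ### The triangle network, with vertices `0, 1, 2` and edges `01, 12, 02` -/

/-- Coordinates of the tensor space `V₀ ⊗ V₁ ⊗ V₂ = ℂ^{n₀} ⊗ ℂ^{n₁} ⊗ ℂ^{n₂}`. -/
abbrev TensorSpace (n0 n1 n2 : ℕ) : Type := Fin n0 × Fin n1 × Fin n2 → ℂ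

/-- The graph tensor of the triangle: the tensor product of the three identity tensors of the
bond spaces, regrouped as an element of `W₀ ⊗ W₁ ⊗ W₂` where `W₀ = E₀₁ ⊗ E₀₂`,
`W₁ = E₀₁ ⊗ E₁₂`, `W₂ = E₁₂ ⊗ E₀₂` (up to duals), in coordinates. -/
def graphTensor (m01 m12 m02 : ℕ)
    (w0 : Fin m01 × Fin m02) (w1 : Fin m01 × Fin m12) (w2 : Fin m12 × Fin m02) : ℂ :=
  (if w0.1 = w1.1 then 1 else 0) * (if w1.2 = w2.1 then 1 else 0) *
    (if w0.2 = w2.2 then 1 else 0)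

/-- The map `(X₀, X₁, X₂) ↦ (X₀ ⊗ X₁ ⊗ X₂) T(Δ, 𝐦)` on `∏ Hom(Wᵢ, Vᵢ)`. -/
def triangleMap (m01 m12 m02 n0 n1 n2 : ℕ)
    (X0 : Matrix (Fin n0) (Fin m01 × Fin m02) ℂ)
    (X1 : Matrix (Fin n1) (Fin m01 × Fin m12) ℂ)
    (X2 : Matrix (Fin n2) (Fin m12 × Fin m02) ℂ) : TensorSpace n0 n1 n2 :=
  fun s => ∑ w0, ∑ w1, ∑ w2,
    X0 s.1 w0 * X1 s.2.1 w1 * X2 s.2.2 w2 * graphTensor m01 m12 m02 w0 w1 w2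

/-- The tensor network variety of the triangle with bond dimensions `(m₀₁, m₁₂, m₀₂)` and
physical dimensions `(n₀, n₁, n₂)`. -/
def triangleTNS (m01 m12 m02 n0 n1 n2 : ℕ) : Set (TensorSpace n0 n1 n2) :=
  zariskiClosure {T | ∃ X0 X1 X2, T = triangleMap m01 m12 m02 n0 n1 n2 X0 X1 X2}

/-- The parameter count
`∑_{i} (nᵢ ∏_{e ∋ i} m_e - 1) - ∑_{e} (m_e² - 1) + 1` of the triangle network. -/
def triangleParamCount (m01 m12 m02 n0 n1 n2 : ℕ) : ℤ :=
  (((n0 : ℤ) * (m01 * m02) - 1) + ((n1 : ℤ) * (m01 * m12) - 1) + ((n2 : ℤ) * (m12 * m02) - 1))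
    - (((m01 : ℤ) ^ 2 - 1) + ((m12 : ℤ) ^ 2 - 1) + ((m02 : ℤ) ^ 2 - 1)) + 1

/-- The expected dimension of the triangle tensor network variety. -/
def triangleExpDim (m01 m12 m02 n0 n1 n2 : ℕ) : ℤ :=
  min (triangleParamCount m01 m12 m02 n0 n1 n2) ((n0 : ℤ) * n1 * n2)

/-- The defect of the triangle tensor network variety. -/
def triangleDefect (m01 m12 m02 n0 n1 n2 : ℕ) : ℤ :=
  triangleExpDim m01 m12 m02 n0 n1 n2 - affineDimInt (triangleTNS m01 m12 m02 n0 n1 n2)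

/-- The fiber defect of the triangle tensor network variety. -/
def triangleFiberDefect (m01 m12 m02 n0 n1 n2 : ℕ) : ℤ :=
  triangleParamCount m01 m12 m02 n0 n1 n2 - affineDimInt (triangleTNS m01 m12 m02 n0 n1 n2)

/-! ### Pencils of matrices -/

/-- A pencil in `ℂ² ⊗ ℂ^I ⊗ ℂ^J`: the coefficient matrices, on the fixed basis `a₀, a₁` of
`ℂ²`, of a matrix of linear forms. -/
abbrev Pencil (I J : Type) : Type := Fin 2 → Matrix I J ℂ

/-- A tensor in `ℂ² ⊗ ℂ^{n₁} ⊗ ℂ^{n₂}` regarded as a pencil. -/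
def toPencil {n1 n2 : ℕ} (T : TensorSpace 2 n1 n2) : Pencil (Fin n1) (Fin n2) :=
  fun a => Matrix.of fun j k => T (a, j, k)

/-- The Jordan pencil `J_p(z)`, with `z = z 0 • a₀ + z 1 • a₁` on the diagonal and `a₁` on the
superdiagonal. -/
def jordanPencil (p : ℕ) (z : Fin 2 → ℂ) : Pencil (Fin p) (Fin p) :=
  fun a => Matrix.of fun i j =>
    if i = j then z a else if (i : ℕ) + 1 = (j : ℕ) then (if a = 1 then 1 else 0) else 0

/-- The block sum `⊞ₖ Tₖ` of a finite family of pencils. -/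
def blockSum {K : Type} [DecidableEq K] {I J : K → Type}
    (T : (k : K) → Pencil (I k) (J k)) : Pencil ((k : K) × I k) ((k : K) × J k) :=
  fun a => Matrix.blockDiagonal' fun k => T k a

/-- The Kronecker product `T ⊠ M` of a pencil and a matrix. -/
def kroneckerProd {I J K L : Type} (T : Pencil I J) (M : Matrix K L ℂ) :
    Pencil (I × K) (J × L) :=
  fun a => T a ⊗ₖ M

/-- `T = (g₁ ⊗ g₂) S` for some linear isomorphisms `g₁, g₂` of the second and of the third
tensor factor: the two pencils agree after a change of coordinates in these two factors. -/
def PencilEquiv {I J I' J' : Type} [Fintype I] [DecidableEq I] [Fintype J] [DecidableEq J]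
    [Fintype I'] [DecidableEq I'] [Fintype J'] [DecidableEq J']
    (T : Pencil I J) (S : Pencil I' J') : Prop :=
  ∃ (g1 : (I' → ℂ) ≃ₗ[ℂ] (I → ℂ)) (g2 : (J' → ℂ) ≃ₗ[ℂ] (J → ℂ)), ∀ a,
    T a = LinearMap.toMatrix' (g1 : (I' → ℂ) →ₗ[ℂ] (I → ℂ)) * S a *
      (LinearMap.toMatrix' (g2 : (J' → ℂ) →ₗ[ℂ] (J → ℂ))).transpose

/-- The pencil `⊞_{i=1}^m (J₁(zᵢ) ⊠ I_q)`, where `zᵢ = z (i, 0) • a₀ + z (i, 1) • a₁`. -/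
def normalForm (m q : ℕ) (z : Fin m × Fin 2 → ℂ) :
    Pencil ((_ : Fin m) × (Fin 1 × Fin q)) ((_ : Fin m) × (Fin 1 × Fin q)) :=
  blockSum fun i : Fin m =>
    kroneckerProd (jordanPencil 1 fun a => z (i, a)) (1 : Matrix (Fin q) (Fin q) ℂ)

end TensorNetwork

end

/-! Write `q` for `m12`. As a pencil, a network tensor is `X (Z ⊠ I_q) Y` with `Z` an arbitrary `m ×
m` pencil and `X`, `Y` arbitrary square matrices (`triangleMap_eq`). For generic `Z` the matrix `Z₀`
is invertible and `Z₀⁻¹ Z₁` has distinct eigenvalues, so `Z` is diagonal up to factors that `X` and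
`Y` absorb. Hence the variety is the closure of the tensors `X diag(zᵢ) Y`
(`triangleTNS_eq_closure_range_diagTensor`). This gives the converse half of (1); the generic half
follows from Chevalley's theorem (`exists_open_subset_image`).

For the dimension, redundancy is removed: block diagonal matrices commute with the pencil, so
generically `X` can be given identity diagonal blocks and `zᵢ` the form `(1, μᵢ)`. The remaining
`(n² - m q²) + m + n²` parameters are independent by a Jacobian criterion stated with derivations
(`affineDim_closure_range_polyMap`, `derivation_eq_zero_of_pencil`).

The defect appears because `GL_q^m`, of dimension `m q²`, commutes with a generic diagonal pencil,
while the parameter count only accounts for `GL_q` and an `(m-1)`-dimensional torus; the difference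
is `(m-1)(q²-1)`. -/

open scoped Kronecker

noncomputable section

namespace TensorNetwork

open MvPolynomial

/-! ### Images of polynomial maps, their closures, and Chevalley's theorem. -/

section PolynomialMaps

variable {σ τ : Type}

/-- The polynomial map `ℂ^τ → ℂ^σ` with components `P`. -/
def polyMap (P : σ → MvPolynomial τ ℂ) (y : τ → ℂ) : σ → ℂ := fun s => eval y (P s)

lemma aeval_polyMap (P : σ → MvPolynomial τ ℂ) (y : τ → ℂ) (f : MvPolynomial σ ℂ) :
    aeval (polyMap P y) f = eval y (bind₁ P f) := by
  rw [← MvPolynomial.coe_aeval_eq_eval, RingHom.coe_coe, aeval_bind₁]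
  rfl

lemma subset_zariskiClosure (S : Set (σ → ℂ)) : S ⊆ zariskiClosure S :=
  zeroLocus_vanishingIdeal_le S

lemma vanishingIdeal_zariskiClosure (S : Set (σ → ℂ)) :
    vanishingIdeal ℂ (zariskiClosure S) = vanishingIdeal ℂ S :=
  le_antisymm (vanishingIdeal_anti_mono (subset_zariskiClosure S))
    (le_vanishingIdeal_zeroLocus _)

lemma zariskiClosure_subset_of_subset {S T : Set (σ → ℂ)} (h : S ⊆ zariskiClosure T) :
    zariskiClosure S ⊆ zariskiClosure T := by
  apply zeroLocus_anti_mono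
  rw [← vanishingIdeal_zariskiClosure T]
  exact vanishingIdeal_anti_mono h

lemma mem_vanishingIdeal_range_polyMap (P : σ → MvPolynomial τ ℂ) (f : MvPolynomial σ ℂ) :
    f ∈ vanishingIdeal ℂ (Set.range (polyMap P)) ↔ bind₁ P f = 0 := by
  rw [mem_vanishingIdeal_iff, Set.forall_mem_range]
  simp only [aeval_polyMap]
  exact ⟨fun h => MvPolynomial.funext fun y => by rw [h, map_zero], fun h y => by rw [h, map_zero]⟩

/-- Thus the coordinate ring of the closure of the image is the subring of `ℂ[τ]` generated by the
components of `P`. -/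
lemma vanishingIdeal_range_polyMap (P : σ → MvPolynomial τ ℂ) :
    vanishingIdeal ℂ (Set.range (polyMap P)) = RingHom.ker (bind₁ P) := by
  ext f
  rw [mem_vanishingIdeal_range_polyMap, RingHom.mem_ker]

/-- If the generic value of a polynomial map lies in a closed set, every value does. -/
lemma polyMap_mem_zariskiClosure (P : σ → MvPolynomial τ ℂ) {h : MvPolynomial τ ℂ} (h0 : h ≠ 0)
    {S : Set (σ → ℂ)} (hS : ∀ y, eval y h ≠ 0 → polyMap P y ∈ zariskiClosure S) (y : τ → ℂ) :
    polyMap P y ∈ zariskiClosure S := by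
  intro f hf
  -- The product vanishes at every point, and the polynomial ring is a domain, so `h` can be
  -- cancelled.
  have h1 : bind₁ P f * h = 0 := by
    refine MvPolynomial.funext fun y => ?_
    rw [map_mul, map_zero]
    by_cases hy : eval y h = 0
    · rw [hy, mul_zero]
    · rw [← aeval_polyMap, hS y hy f hf, zero_mul]
  rw [aeval_polyMap, (mul_eq_zero.mp h1).resolve_right h0, map_zero]

lemma finitePresentation_bind₁ [Finite σ] [Finite τ] (P : σ → MvPolynomial τ ℂ) :
    (bind₁ P).toRingHom.FinitePresentation := by
  apply RingHom.FinitePresentation.of_finiteType.mp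
  have : (bind₁ P).FiniteType := by
    apply AlgHom.FiniteType.of_comp_finiteType (f := Algebra.ofId ℂ (MvPolynomial σ ℂ))
    have : (bind₁ P).comp (Algebra.ofId ℂ _) = Algebra.ofId ℂ (MvPolynomial τ ℂ) :=
      Subsingleton.elim _ _
    rw [this]
    change (algebraMap ℂ (MvPolynomial τ ℂ)).FiniteType
    rw [RingHom.finiteType_algebraMap]
    infer_instance
  exact this

/-- The image of a non-empty open set under a polynomial map contains a non-empty open subset of
the closure of the image. -/
lemma exists_open_subset_image [Finite σ] [Finite τ] (P : σ → MvPolynomial τ ℂ)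
    {g : MvPolynomial τ ℂ} (hg : g ≠ 0) :
    ∃ r : MvPolynomial σ ℂ, r ∉ vanishingIdeal ℂ (Set.range (polyMap P)) ∧
      ∀ T ∈ zariskiClosure (Set.range (polyMap P)), eval T r ≠ 0 →
        ∃ y, eval y g ≠ 0 ∧ polyMap P y = T := by
  -- Chevalley: the image of `D(g)` is a finite union of sets `V(I) \ V(f)`. The piece containing
  -- the generic point of the closure has equations vanishing on the whole closure, and its `f`
  -- serves as `r`.
  obtain ⟨S, hS⟩ := PrimeSpectrum.exists_constructibleSetData_iff.mpr
    (PrimeSpectrum.isConstructible_comap_image (finitePresentation_bind₁ P)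
      (PrimeSpectrum.isConstructible_basicOpen (f := g)))
  have hbot : PrimeSpectrum.comap (bind₁ P).toRingHom ⟨⊥, Ideal.isPrime_bot⟩ ∈ S.toSet := by
    rw [hS]
    exact ⟨_, by simpa [PrimeSpectrum.mem_basicOpen] using hg, rfl⟩
  simp only [PrimeSpectrum.ConstructibleSetData.toSet, Set.mem_iUnion] at hbot
  obtain ⟨C, hC, hbot⟩ := hbot
  obtain ⟨h1, h2⟩ := hbot
  have hker : ∀ f, f ∈ (PrimeSpectrum.comap (bind₁ P).toRingHom
      ⟨⊥, Ideal.isPrime_bot⟩).asIdeal ↔ f ∈ vanishingIdeal ℂ (Set.range (polyMap P)) := by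
    intro f
    rw [mem_vanishingIdeal_range_polyMap]
    rfl
  refine ⟨C.f, ?_, fun T hT hr => ?_⟩
  · rw [← hker]
    simpa [PrimeSpectrum.mem_zeroLocus] using h2
  have hTC : (pointToPoint T : PrimeSpectrum (MvPolynomial σ ℂ)) ∈ S.toSet := by
    simp only [PrimeSpectrum.ConstructibleSetData.toSet, Set.mem_iUnion]
    refine ⟨C, hC, ?_, ?_⟩
    · rintro f hf
      exact (mem_vanishingIdeal_singleton_iff _ _).mpr (hT f ((hker f).mp (h1 hf)))
    · rw [PrimeSpectrum.mem_zeroLocus, Set.singleton_subset_iff]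
      intro h
      exact hr ((mem_vanishingIdeal_singleton_iff _ _).mp h)
  rw [hS] at hTC
  obtain ⟨Q, hgQ, hQ⟩ := hTC
  -- `Q` is only a prime above the point `T`; the Nullstellensatz supplies a closed point `y` of
  -- `V(Q)` with `g y ≠ 0`.
  have hgQ' : g ∉ vanishingIdeal ℂ (zeroLocus ℂ Q.asIdeal) := by
    rw [IsPrime.vanishingIdeal_zeroLocus]
    exact hgQ
  rw [mem_vanishingIdeal_iff] at hgQ'
  push Not at hgQ'
  obtain ⟨y, hy, hgy⟩ := hgQ'
  refine ⟨y, hgy, funext fun s => ?_⟩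
  -- `Q` contracts to the maximal ideal of `T`, so `P s - T s` lies in `Q` and vanishes at `y`.
  have hs : X s - MvPolynomial.C (T s) ∈ (PrimeSpectrum.comap (bind₁ P).toRingHom Q).asIdeal := by
    rw [hQ]
    exact (mem_vanishingIdeal_singleton_iff _ _).mpr (by simp)
  have := hy _ hs
  simpa [polyMap, sub_eq_zero, MvPolynomial.coe_aeval_eq_eval] using this

lemma isZariskiOpen_ne_zero (r : MvPolynomial σ ℂ) : IsZariskiOpen {T | eval T r ≠ 0} := by
  refine ⟨Ideal.span {r}, ?_⟩
  rw [zeroLocus_span]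
  ext T
  simp

lemma IsZariskiOpen.exists_polynomial {Ω : Set (σ → ℂ)} (hΩ : IsZariskiOpen Ω) (hne : Ω.Nonempty) :
    ∃ g : MvPolynomial σ ℂ, g ≠ 0 ∧ ∀ z, eval z g ≠ 0 → z ∈ Ω := by
  obtain ⟨I, hI⟩ := hΩ
  obtain ⟨z, hz⟩ := hne
  have hz' : z ∉ zeroLocus ℂ I := by
    rw [← hI]
    simpa using hz
  rw [mem_zeroLocus_iff] at hz'
  push Not at hz'
  obtain ⟨g, hg, hgz⟩ := hz'
  refine ⟨g, fun h => hgz (by rw [h, map_zero]), fun w hw => ?_⟩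
  by_contra hwΩ
  have : w ∈ zeroLocus ℂ I := by
    rw [← hI]
    exact hwΩ
  exact hw (this g hg)

/-- A property of the generic values of a polynomial map holds generically on the closure of its
image. -/
lemma holdsGenerically_of_polyMap [Finite σ] [Finite τ] (P : σ → MvPolynomial τ ℂ)
    {g : MvPolynomial τ ℂ} (hg : g ≠ 0) {Q : (σ → ℂ) → Prop}
    (hQ : ∀ y, eval y g ≠ 0 → Q (polyMap P y)) :
    HoldsGenerically (zariskiClosure (Set.range (polyMap P))) Q := by
  obtain ⟨r, hr, h⟩ := exists_open_subset_image P hg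
  refine ⟨{T | eval T r ≠ 0}, isZariskiOpen_ne_zero r, ?_, ?_⟩
  · apply zariskiClosure_subset_of_subset
    rintro _ ⟨y, rfl⟩
    rw [mem_vanishingIdeal_range_polyMap] at hr
    -- Density: the pullback of `r` is a non-zero polynomial, so it suffices to treat parameters
    -- where it does not vanish.
    refine polyMap_mem_zariskiClosure P hr (fun y hy => ?_) y
    refine subset_zariskiClosure _ ⟨subset_zariskiClosure _ ⟨y, rfl⟩, ?_⟩
    rwa [← aeval_polyMap] at hy
  · rintro T ⟨hT, hrT⟩
    obtain ⟨y, hy, rfl⟩ := h T hT hrT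
    exact hQ y hy

end PolynomialMaps

/-! ### Krull dimension, transcendence degree and the Jacobian criterion. -/

section Dimension

open Algebra

/-- An injective integral extension preserves the Krull dimension. -/
lemma ringKrullDim_eq_of_isIntegral {A B : Type*} [CommRing A] [CommRing B] [Algebra A B]
    [Algebra.IsIntegral A B] (hinj : Function.Injective (algebraMap A B)) :
    ringKrullDim A = ringKrullDim B := by
  apply le_antisymm
  · refine iSup_le fun l => ?_
    -- Lying over lifts the head of the chain; going up lifts the rest.
    obtain ⟨P, -, hP, hlo⟩ := Ideal.exists_ideal_over_prime_of_isIntegral (S := B)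
      l.head.asIdeal ⊥ (by
        rw [← RingHom.ker_eq_comap_bot,
          (RingHom.injective_iff_ker_eq_bot _).mp hinj]
        exact bot_le)
    have : P.LiesOver l.head.asIdeal := ⟨hlo.symm⟩
    obtain ⟨L, hL, -⟩ := Ideal.exists_ltSeries_of_hasGoingUp l P
    rw [← hL]
    exact le_iSup_of_le L le_rfl
  · refine Order.krullDim_le_of_strictMono (PrimeSpectrum.comap (algebraMap A B)) ?_
    intro P Q h
    exact Ideal.IsIntegral.comap_lt_comap h

/-- The dimension of a finitely generated domain over a field is its transcendence degree. -/
lemma ringKrullDim_eq_of_trdeg {k R : Type} [Field k] [CommRing R] [IsDomain R] [Algebra k R]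
    [Algebra.FiniteType k R] {d : ℕ} (h : Algebra.trdeg k R = d) :
    ringKrullDim R = d := by
  -- Noether normalization: the number `s` of variables is both the Krull dimension and the
  -- transcendence degree of `R`.
  obtain ⟨s, g, hg, hint⟩ := exists_integral_inj_algHom_of_fg k R
  algebraize [g.toRingHom]
  have : Algebra.IsIntegral (MvPolynomial (Fin s) k) R := ⟨hint⟩
  have h1 : ringKrullDim (MvPolynomial (Fin s) k) = ringKrullDim R :=
    ringKrullDim_eq_of_isIntegral hg
  have h2 : Algebra.trdeg k (MvPolynomial (Fin s) k) + Algebra.trdeg (MvPolynomial (Fin s) k) R =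
      Algebra.trdeg k R := by
    have : FaithfulSMul (MvPolynomial (Fin s) k) R :=
      (faithfulSMul_iff_algebraMap_injective _ _).mpr hg
    have : IsScalarTower k (MvPolynomial (Fin s) k) R :=
      IsScalarTower.of_algebraMap_eq fun x => (g.commutes x).symm
    exact trdeg_add_eq _ _
  rw [← h1, MvPolynomial.ringKrullDim_of_isNoetherianRing, ringKrullDim_eq_zero_of_field]
  rw [trdeg_eq_zero (R := MvPolynomial (Fin s) k), h, MvPolynomial.trdeg_of_isDomain] at h2
  simp only [Cardinal.mk_fintype, Fintype.card_fin, Cardinal.lift_natCast, add_zero] at h2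
  have : s = d := by exact_mod_cast h2
  simp [this]

variable {σ τ : Type}

/-- An extension of finitely generated domains in characteristic zero is algebraic if every
derivation that kills the smaller one vanishes. -/
lemma isAlgebraic_of_derivation {k A M K : Type} [Field k] [CharZero k] [CommRing A] [IsDomain A]
    [CommRing M] [IsDomain M] [Field K] [Algebra k A] [Algebra k M] [Algebra A M]
    [Algebra k K] [Algebra A K] [Algebra M K] [IsScalarTower k M K] [IsScalarTower k A K]
    [IsScalarTower A M K] [FaithfulSMul A K] [IsFractionRing M K] [Algebra.FiniteType k M]
    (hD : ∀ D : Derivation k K K, (∀ a : A, D (algebraMap A K a) = 0) →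
      ∀ a : M, D (algebraMap M K a) = 0) : Algebra.IsAlgebraic A M := by
  let F := FractionRing A
  let : Algebra F K := FractionRing.liftAlgebra A K
  have : IsScalarTower k F K := by
    refine IsScalarTower.of_algebraMap_eq fun x => ?_
    rw [IsScalarTower.algebraMap_apply k A K, IsScalarTower.algebraMap_apply k A F,
      ← IsScalarTower.algebraMap_apply A F K]
  have : Algebra.EssFiniteType M K := Algebra.EssFiniteType.of_isLocalization _ (nonZeroDivisors M)
  have : Algebra.EssFiniteType k K := Algebra.EssFiniteType.comp k M K
  have : Algebra.EssFiniteType F K := Algebra.EssFiniteType.of_comp k F K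
  have : CharZero F := charZero_of_injective_algebraMap (algebraMap k F).injective
  -- The dual of the Kähler differentials is the space of `F`-derivations of `K`. These vanish on
  -- `M` by `hD`, hence on fractions by the quotient rule.
  have hunram : Algebra.FormallyUnramified F K := by
    refine ⟨?_⟩
    rw [← Module.subsingleton_dual_iff K]
    refine (KaehlerDifferential.linearMapEquivDerivation F K).toEquiv.subsingleton_congr.mpr ?_
    refine subsingleton_of_forall_eq 0 fun D => ?_
    have h1 := hD (D.restrictScalars k) fun a => by
      rw [IsScalarTower.algebraMap_apply A F K]
      exact D.map_algebraMap _
    ext x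
    obtain ⟨a, b, hb, rfl⟩ := IsFractionRing.div_surjective (A := M) x
    have ha : D (algebraMap M K a) = 0 := h1 a
    have hb : D (algebraMap M K b) = 0 := h1 b
    rw [Derivation.leibniz_div, ha, hb]
    simp
  have : Algebra.IsSeparable F K := (Algebra.FormallyUnramified.iff_isSeparable F K).mp hunram
  have : Algebra.IsAlgebraic A K :=
    (IsFractionRing.comap_isAlgebraic_iff (A := A) (K := F) (C := K)).mpr inferInstance
  exact Algebra.IsAlgebraic.tower_bot_of_injective (A := K) (IsFractionRing.injective M K)

/-- Jacobian criterion: the closure of the image of a polynomial map has the dimension of the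
source if no non-zero derivation of the field of rational functions kills all components. -/
lemma affineDim_closure_range_polyMap [Finite σ] [Fintype τ] (P : σ → MvPolynomial τ ℂ)
    (hD : ∀ D : Derivation ℂ (FractionRing (MvPolynomial τ ℂ)) (FractionRing (MvPolynomial τ ℂ)),
      (∀ s, D (algebraMap (MvPolynomial τ ℂ) _ (P s)) = 0) →
      ∀ t, D (algebraMap (MvPolynomial τ ℂ) _ (X t)) = 0) :
    affineDim (zariskiClosure (Set.range (polyMap P))) = (Fintype.card τ : ℕ) := by
  -- `A` is the coordinate ring; once `ℂ[τ]` is algebraic over it, both have transcendence degree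
  -- `|τ|`.
  let A := (bind₁ P).range
  have hfin : Algebra.FiniteType ℂ A :=
    Algebra.FiniteType.of_surjective (bind₁ P).rangeRestrict (bind₁ P).rangeRestrict_surjective
  have hinj : FaithfulSMul A (FractionRing (MvPolynomial τ ℂ)) :=
    (faithfulSMul_iff_algebraMap_injective _ _).mpr <|
      (IsFractionRing.injective (MvPolynomial τ ℂ) _).comp Subtype.val_injective
  have halg : Algebra.IsAlgebraic A (MvPolynomial τ ℂ) := by
    refine isAlgebraic_of_derivation (k := ℂ)
      (K := FractionRing (MvPolynomial τ ℂ)) fun D h a => ?_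
    have h1 := hD D fun s => h ⟨P s, X s, bind₁_X_right P s⟩
    have h2 : D.compAlgebraMap (MvPolynomial τ ℂ) = 0 :=
      MvPolynomial.derivation_ext fun t => h1 t
    exact congrArg (fun D => D a) h2
  have htr : Algebra.trdeg ℂ A = (Fintype.card τ : ℕ) := by
    have := trdeg_add_eq ℂ A (A := MvPolynomial τ ℂ)
    rw [trdeg_eq_zero (R := A), add_zero, MvPolynomial.trdeg_of_isDomain] at this
    simpa using this
  rw [affineDim, vanishingIdeal_zariskiClosure, vanishingIdeal_range_polyMap,
    ← ringKrullDim_eq_of_trdeg htr]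
  exact ringKrullDim_eq_of_ringEquiv (RingHom.quotientKerEquivRange (bind₁ P).toRingHom)

end Dimension

/-! ### Tensors built from pencils, over any commutative ring. -/

section PencilTensor

variable {m q n : ℕ} {A A' : Type*} [CommRing A] [CommRing A']

/-- The tensor in `A² ⊗ Aⁿ ⊗ Aⁿ` given by the pencil `X W Y`, where the rows and columns are
numbered by `e`. -/
def pencilTensor (e : Fin m × Fin q ≃ Fin n) (X : Matrix (Fin m × Fin q) (Fin m × Fin q) A)
    (W : Fin 2 → Matrix (Fin m × Fin q) (Fin m × Fin q) A)
    (Y : Matrix (Fin m × Fin q) (Fin m × Fin q) A) : Fin 2 × Fin n × Fin n → A :=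
  fun s => (X * W s.1 * Y) (e.symm s.2.1) (e.symm s.2.2)

/-- The diagonal pencil with entries `zᵢ`, each repeated `q` times. -/
def diagPencil (q : ℕ) (z : Fin m × Fin 2 → A) (a : Fin 2) :
    Matrix (Fin m × Fin q) (Fin m × Fin q) A :=
  Matrix.diagonal fun b => z (b.1, a)

/-- The pairs `(1, μᵢ)`. -/
def affinePoint (μ : Fin m → A) : Fin m × Fin 2 → A :=
  fun p => if p.2 = 0 then 1 else μ p.1

/-- The matrix with identity diagonal blocks and the given entries off the diagonal blocks. -/
def blockUnipotent (N : {p : (Fin m × Fin q) × (Fin m × Fin q) // p.1.1 ≠ p.2.1} → A) :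
    Matrix (Fin m × Fin q) (Fin m × Fin q) A :=
  Matrix.of fun b c => if h : b.1 = c.1 then (if b = c then 1 else 0) else N ⟨(b, c), h⟩

/-- Compatibility with ring homomorphisms lets one formula serve over `ℂ`, over a polynomial ring
and over its fraction field. -/
lemma map_pencilTensor (φ : A →+* A') (e : Fin m × Fin q ≃ Fin n)
    (X : Matrix (Fin m × Fin q) (Fin m × Fin q) A)
    (W : Fin 2 → Matrix (Fin m × Fin q) (Fin m × Fin q) A)
    (Y : Matrix (Fin m × Fin q) (Fin m × Fin q) A) (s : Fin 2 × Fin n × Fin n) :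
    φ (pencilTensor e X W Y s) =
      pencilTensor e (X.map φ) (fun a => (W a).map φ) (Y.map φ) s := by
  simp only [pencilTensor, ← Matrix.map_mul, Matrix.map_apply]

lemma map_diagPencil (φ : A →+* A') (z : Fin m × Fin 2 → A) (a : Fin 2) :
    (diagPencil q z a).map φ = diagPencil q (fun p => φ (z p)) a := by
  rw [diagPencil, Matrix.diagonal_map (map_zero φ)]
  rfl

lemma map_affinePoint (φ : A →+* A') (μ : Fin m → A) :
    (fun p => φ (affinePoint μ p)) = affinePoint fun i => φ (μ i) := by
  ext p
  simp only [affinePoint]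
  split_ifs <;> simp

lemma map_blockUnipotent (φ : A →+* A')
    (N : {p : (Fin m × Fin q) × (Fin m × Fin q) // p.1.1 ≠ p.2.1} → A) :
    (blockUnipotent N).map φ = blockUnipotent fun p => φ (N p) := by
  ext b c
  simp only [blockUnipotent, Matrix.map_apply, Matrix.of_apply]
  split_ifs <;> simp

lemma blockUnipotent_apply_of_eq
    (N : {p : (Fin m × Fin q) × (Fin m × Fin q) // p.1.1 ≠ p.2.1} → A)
    {b c : Fin m × Fin q} (h : b.1 = c.1) :
    blockUnipotent N b c = (1 : Matrix (Fin m × Fin q) (Fin m × Fin q) A) b c := by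
  simp [blockUnipotent, h, Matrix.one_apply]

lemma blockUnipotent_zero :
    blockUnipotent (fun _ => 0) = (1 : Matrix (Fin m × Fin q) (Fin m × Fin q) A) := by
  ext b c
  by_cases h : b.1 = c.1
  · rw [blockUnipotent_apply_of_eq _ h]
  · have : b ≠ c := fun h' => h (by rw [h'])
    simp [blockUnipotent, h, this]

lemma diagPencil_affinePoint_zero (μ : Fin m → A) : diagPencil q (affinePoint μ) 0 = 1 := by
  simp [diagPencil, affinePoint]

lemma diagPencil_affinePoint_one (μ : Fin m → A) :
    diagPencil q (affinePoint μ) 1 = Matrix.diagonal fun b => μ b.1 := by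
  simp [diagPencil, affinePoint]

end PencilTensor

/-! ### Infinitesimal rigidity of the normalized diagonal pencils. -/

section Derivation

variable {m q : ℕ} {k K : Type*} [CommRing k] [Field K] [Algebra k K]

lemma matrix_mul_map_derivation {l : Type*} [Fintype l] (D : Derivation k K K)
    (M N : Matrix l l K) : (M * N).map D = M.map D * N + M * N.map D := by
  ext i j
  simp only [Matrix.map_apply, Matrix.mul_apply, Matrix.add_apply, map_sum, Derivation.leibniz,
    smul_eq_mul, ← Finset.sum_add_distrib]
  exact Finset.sum_congr rfl fun x _ => by ring

/-- The pair `(X Y, X M Y)` with `M = diag(μᵢ)` determines the derivations of `X`, `μ`, `Y`, when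
the diagonal blocks of `X` are normalized. -/
lemma derivation_eq_zero_of_pencil [NeZero q] (D : Derivation k K K)
    {X Y : Matrix (Fin m × Fin q) (Fin m × Fin q) K} {μ : Fin m → K}
    (hX : X.det ≠ 0) (hY : Y.det ≠ 0) (hμ : Function.Injective μ)
    (hX1 : ∀ b c : Fin m × Fin q, b.1 = c.1 →
      X b c = (1 : Matrix (Fin m × Fin q) (Fin m × Fin q) K) b c)
    (h0 : (X * Y).map D = 0) (h1 : (X * Matrix.diagonal (fun b : Fin m × Fin q => μ b.1) * Y).map D = 0) :
    X.map D = 0 ∧ (∀ i, D (μ i) = 0) ∧ Y.map D = 0 := by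
  set M : Matrix (Fin m × Fin q) (Fin m × Fin q) K := Matrix.diagonal (fun b => μ b.1) with hM
  have hXu : IsUnit X.det := hX.isUnit
  have hYu : IsUnit Y.det := hY.isUnit
  -- The logarithmic derivative of `X`: the first equation becomes `DY = -A Y`, the second `A M - M
  -- A + DM = 0`.
  set A := X⁻¹ * X.map D with hA
  have hXA : X.map D = X * A := by rw [hA, Matrix.mul_nonsing_inv_cancel_left _ _ hXu]
  rw [matrix_mul_map_derivation, hXA] at h0
  have hYA : Y.map D = - (A * Y) := by
    have : X * (A * Y + Y.map D) = 0 := by rw [mul_add, ← mul_assoc, h0]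
    have := congrArg (X⁻¹ * ·) this
    simp only [Matrix.nonsing_inv_mul_cancel_left _ _ hXu, mul_zero] at this
    rw [eq_neg_iff_add_eq_zero, add_comm, this]
  rw [matrix_mul_map_derivation, matrix_mul_map_derivation, hXA, hYA] at h1
  have h2 : A * M + M.map D - M * A = 0 := by
    have h3 : X * (A * M + M.map D - M * A) * Y = 0 := by
      rw [← h1]
      noncomm_ring
    have := congrArg (fun Z => X⁻¹ * Z * Y⁻¹) h3
    simpa only [← mul_assoc, Matrix.nonsing_inv_mul _ hXu, one_mul, mul_zero, zero_mul,
      Matrix.mul_nonsing_inv_cancel_right _ _ hYu] using this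
  have hMD : M.map D = Matrix.diagonal fun b => D (μ b.1) := by
    rw [hM, Matrix.diagonal_map (map_zero D)]
  -- A commutator with a diagonal matrix has zero diagonal.
  have hμ0 : ∀ i, D (μ i) = 0 := by
    intro i
    have := congrFun (congrFun h2 (i, 0)) (i, 0)
    rw [hMD] at this
    simp only [hM, Matrix.sub_apply, Matrix.add_apply, Matrix.mul_diagonal, Matrix.diagonal_mul,
      Matrix.diagonal_apply_eq, Matrix.zero_apply] at this
    linear_combination this
  have hAoff : ∀ b c : Fin m × Fin q, b.1 ≠ c.1 → A b c = 0 := by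
    intro b c hbc
    have := congrFun (congrFun h2 b) c
    rw [hMD] at this
    have hbc' : b ≠ c := fun h => hbc (by rw [h])
    simp only [hM, Matrix.sub_apply, Matrix.add_apply, Matrix.mul_diagonal, Matrix.diagonal_mul,
      Matrix.diagonal_apply_ne _ hbc', Matrix.zero_apply] at this
    have h4 : A b c * (μ c.1 - μ b.1) = 0 := by linear_combination this
    exact (mul_eq_zero.mp h4).resolve_right (sub_ne_zero.mpr fun h => hbc (hμ h).symm)
  -- `A` is now block diagonal and `X` has identity diagonal blocks, so `X * A` and `A` share their
  -- diagonal blocks; those of `DX` vanish, being derivatives of constants.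
  have hA0 : A = 0 := by
    ext b c
    by_cases hbc : b.1 = c.1
    · have h5 : X.map D b c = 0 := by
        rw [Matrix.map_apply, hX1 b c hbc, Matrix.one_apply]
        split_ifs <;> simp
      have h6 : (X * A) b c = ((1 : Matrix (Fin m × Fin q) (Fin m × Fin q) K) * A) b c := by
        rw [Matrix.mul_apply, Matrix.mul_apply]
        refine Finset.sum_congr rfl fun x _ => ?_
        by_cases hx : x.1 = c.1
        · rw [hX1 b x (hbc.trans hx.symm)]
        · rw [hAoff x c hx, mul_zero, mul_zero]
      rw [hXA, h6, one_mul] at h5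
      exact h5
    · exact hAoff b c hbc
  refine ⟨by rw [hXA, hA0, mul_zero], hμ0, by rw [hYA, hA0, zero_mul, neg_zero]⟩

end Derivation

/-! ### Diagonalization of matrices and pencils with simple spectrum. -/

section Diagonalization

variable {l : Type} [Fintype l] [DecidableEq l]

/-- A complex matrix with separable characteristic polynomial is diagonalizable. -/
lemma exists_diagonalization_of_separable (M : Matrix l l ℂ) (h : M.charpoly.Separable) :
    ∃ (Q : Matrix l l ℂ) (ν : l → ℂ), IsUnit Q ∧ M * Q = Q * Matrix.diagonal ν := by
  -- Separability gives as many distinct roots as the size of the matrix, so `l` can index the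
  -- eigenvalues.
  have hcard : Fintype.card {x // x ∈ M.charpoly.roots.toFinset} = Fintype.card l := by
    rw [Fintype.card_coe, Multiset.toFinset_card_of_nodup (Polynomial.nodup_roots h),
      ← (IsAlgClosed.splits M.charpoly).natDegree_eq_card_roots, M.charpoly_natDegree_eq_dim]
  let f : l ≃ {x // x ∈ M.charpoly.roots.toFinset} := (Fintype.equivOfCardEq hcard).symm
  have hν : ∀ i, ∃ v, Module.End.HasEigenvector (Matrix.toLin' M) (f i : ℂ) v := by
    intro i
    have h1 := (f i).2
    rw [Multiset.mem_toFinset, Polynomial.mem_roots M.charpoly_monic.ne_zero] at h1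
    have : Module.End.HasEigenvalue (Matrix.toLin' M) (f i : ℂ) := by
      rw [Module.End.hasEigenvalue_iff_isRoot_charpoly, Matrix.charpoly_toLin']
      exact h1
    exact this.exists_hasEigenvector
  choose v hv using hν
  have hli := Module.End.eigenvectors_linearIndependent' (Matrix.toLin' M) (fun i => (f i : ℂ))
    (Subtype.val_injective.comp f.injective) v hv
  refine ⟨(Matrix.of v).transpose, fun i => f i, ?_, ?_⟩
  · rw [← Matrix.linearIndependent_cols_iff_isUnit]
    exact hli
  · ext i j
    have := congrFun (hv j).apply_eq_smul i
    rw [Matrix.toLin'_apply] at this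
    rw [Matrix.mul_diagonal, Matrix.transpose_apply, Matrix.of_apply, mul_comm]
    exact this

/-- A regular pencil with separable characteristic polynomial is diagonalizable. -/
lemma exists_diagonalization_pencil (Z0 Z1 : Matrix l l ℂ) (h0 : Z0.det ≠ 0)
    (h : (Z0.adjugate * Z1).charpoly.Separable) :
    ∃ (U V : Matrix l l ℂ) (μ : l → ℂ), Z0 = U * V ∧ Z1 = U * Matrix.diagonal μ * V := by
  obtain ⟨Q, ν, hQ, hν⟩ := exists_diagonalization_of_separable _ h
  have hQ' : IsUnit Q.det := (Matrix.isUnit_iff_isUnit_det Q).mp hQ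
  -- The adjugate keeps the genericity condition polynomial in the entries; it is `det Z0` times the
  -- inverse, which the factor `Z0.det⁻¹` corrects.
  refine ⟨Z0 * Q, Q⁻¹, fun i => Z0.det⁻¹ * ν i, ?_, ?_⟩
  · rw [Matrix.mul_nonsing_inv_cancel_right _ _ hQ']
  · have h1 : Matrix.diagonal (fun i => Z0.det⁻¹ * ν i) = Z0.det⁻¹ • Matrix.diagonal ν := by
      ext i j
      simp [Matrix.diagonal_apply]
    rw [h1, Matrix.mul_smul, mul_assoc Z0, ← hν, ← mul_assoc, ← mul_assoc, Matrix.mul_adjugate,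
      Matrix.smul_mul, Matrix.smul_mul, one_mul, Matrix.smul_mul, Matrix.smul_mul,
      Matrix.mul_nonsing_inv_cancel_right _ _ hQ', smul_smul, inv_mul_cancel₀ h0, one_smul]

end Diagonalization

/-! ### Normalizing the diagonal blocks. -/

section BlockDiagonal

variable {m q : ℕ}

/-- The diagonal blocks of a matrix. -/
def diagBlocks {A : Type*} [CommRing A] (X : Matrix (Fin m × Fin q) (Fin m × Fin q) A) :
    Matrix (Fin m × Fin q) (Fin m × Fin q) A :=
  Matrix.of fun b c => if b.1 = c.1 then X b c else 0

lemma diagBlocks_commute {A : Type*} [CommRing A] (X : Matrix (Fin m × Fin q) (Fin m × Fin q) A)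
    (w : Fin m → A) :
    Commute (diagBlocks X) (Matrix.diagonal fun b : Fin m × Fin q => w b.1) := by
  ext b c
  rw [Matrix.mul_diagonal, Matrix.diagonal_mul, diagBlocks, Matrix.of_apply]
  split_ifs with h
  · rw [h, mul_comm]
  · simp

/-- Generically, a matrix can be normalized to have identity diagonal blocks by a block diagonal
matrix. -/
lemma exists_blockUnipotent_mul (X : Matrix (Fin m × Fin q) (Fin m × Fin q) ℂ)
    (hX : (diagBlocks X).det ≠ 0) : ∃ N, X = blockUnipotent N * diagBlocks X := by
  have hu : IsUnit (diagBlocks X).det := hX.isUnit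
  have hcomm : ∀ w : Fin m → ℂ,
      Commute (diagBlocks X)⁻¹ (Matrix.diagonal fun b : Fin m × Fin q => w b.1) := by
    intro w
    have := diagBlocks_commute X w
    unfold Commute SemiconjBy at this ⊢
    have h1 := congrArg (fun Z => (diagBlocks X)⁻¹ * Z * (diagBlocks X)⁻¹) this
    simp only [← mul_assoc, Matrix.nonsing_inv_mul _ hu, one_mul,
      Matrix.mul_nonsing_inv_cancel_right _ _ hu] at h1
    exact h1.symm
  have hoff : ∀ b c : Fin m × Fin q, b.1 ≠ c.1 → (diagBlocks X)⁻¹ b c = 0 := by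
    intro b c hbc
    -- Commuting with the indicator of the block of `b` kills the entries linking that block to the
    -- others.
    have := congrFun (congrFun (hcomm fun i => if i = b.1 then 1 else 0) b) c
    rw [Matrix.mul_diagonal, Matrix.diagonal_mul] at this
    simpa [hbc.symm] using this.symm
  refine ⟨fun p => (X * (diagBlocks X)⁻¹) p.1.1 p.1.2, ?_⟩
  have : blockUnipotent (fun p : {p : (Fin m × Fin q) × (Fin m × Fin q) // p.1.1 ≠ p.2.1} =>
      (X * (diagBlocks X)⁻¹) p.1.1 p.1.2) = X * (diagBlocks X)⁻¹ := by
    ext b c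
    by_cases hbc : b.1 = c.1
    · rw [blockUnipotent_apply_of_eq _ hbc, ← Matrix.mul_nonsing_inv _ hu, Matrix.mul_apply,
        Matrix.mul_apply]
      refine Finset.sum_congr rfl fun x _ => ?_
      by_cases hx : x.1 = c.1
      · rw [diagBlocks, Matrix.of_apply, if_pos (hbc.trans hx.symm)]
      · rw [hoff x c hx, mul_zero, mul_zero]
    · simp [blockUnipotent, hbc]
  rw [this, Matrix.nonsing_inv_mul_cancel_right _ _ hu]

end BlockDiagonal

/-! ### Three parametrizations and the generic normalization of diagonal pencils. -/

section Parametrizations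

variable {m q n : ℕ}

/-- Parameters of the generic diagonal pencils up to coordinate changes. -/
abbrev DiagParam (m q : ℕ) : Type :=
  (Fin m × Fin 2) ⊕ ((Fin m × Fin q) × (Fin m × Fin q)) ⊕ ((Fin m × Fin q) × (Fin m × Fin q))

/-- Parameters of pencils `Z ⊠ I` up to coordinate changes. -/
abbrev NetworkParam (m q : ℕ) : Type :=
  (Fin 2 × Fin m × Fin m) ⊕ ((Fin m × Fin q) × (Fin m × Fin q)) ⊕
    ((Fin m × Fin q) × (Fin m × Fin q))

/-- Parameters of the normalized diagonal pencils. -/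
abbrev SliceParam (m q : ℕ) : Type :=
  {p : (Fin m × Fin q) × (Fin m × Fin q) // p.1.1 ≠ p.2.1} ⊕ Fin m ⊕
    ((Fin m × Fin q) × (Fin m × Fin q))

/-- The tensors `X diag(zᵢ) Y`. -/
def diagTensor {A : Type*} [CommRing A] (e : Fin m × Fin q ≃ Fin n) (y : DiagParam m q → A) :
    Fin 2 × Fin n × Fin n → A :=
  pencilTensor e (Matrix.of fun b c => y (.inr (.inl (b, c))))
    (diagPencil q fun p => y (.inl p)) (Matrix.of fun b c => y (.inr (.inr (b, c))))

/-- The tensors `X (Z ⊠ I) Y`. -/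
def networkTensor {A : Type*} [CommRing A] (e : Fin m × Fin q ≃ Fin n)
    (y : NetworkParam m q → A) : Fin 2 × Fin n × Fin n → A :=
  pencilTensor e (Matrix.of fun b c => y (.inr (.inl (b, c))))
    (fun a => (Matrix.of fun i k => y (.inl (a, i, k))) ⊗ₖ (1 : Matrix (Fin q) (Fin q) A))
    (Matrix.of fun b c => y (.inr (.inr (b, c))))

/-- The tensors `X diag(1, μᵢ) Y` with `X` having identity diagonal blocks. -/
def sliceTensor {A : Type*} [CommRing A] (e : Fin m × Fin q ≃ Fin n) (y : SliceParam m q → A) :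
    Fin 2 × Fin n × Fin n → A :=
  pencilTensor e (blockUnipotent fun p => y (.inl p))
    (diagPencil q (affinePoint fun i => y (.inr (.inl i))))
    (Matrix.of fun b c => y (.inr (.inr (b, c))))

lemma map_diagTensor {A A' : Type*} [CommRing A] [CommRing A'] (φ : A →+* A')
    (e : Fin m × Fin q ≃ Fin n) (y : DiagParam m q → A) (s : Fin 2 × Fin n × Fin n) :
    φ (diagTensor e y s) = diagTensor e (fun t => φ (y t)) s := by
  rw [diagTensor, map_pencilTensor, diagTensor]
  simp only [map_diagPencil]
  rfl

lemma map_networkTensor {A A' : Type*} [CommRing A] [CommRing A'] (φ : A →+* A')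
    (e : Fin m × Fin q ≃ Fin n) (y : NetworkParam m q → A) (s : Fin 2 × Fin n × Fin n) :
    φ (networkTensor e y s) = networkTensor e (fun t => φ (y t)) s := by
  rw [networkTensor, map_pencilTensor, networkTensor]
  congr 1
  ext a b c
  simp [Matrix.one_apply, apply_ite φ]

lemma map_sliceTensor {A A' : Type*} [CommRing A] [CommRing A'] (φ : A →+* A')
    (e : Fin m × Fin q ≃ Fin n) (y : SliceParam m q → A) (s : Fin 2 × Fin n × Fin n) :
    φ (sliceTensor e y s) = sliceTensor e (fun t => φ (y t)) s := by
  rw [sliceTensor, map_pencilTensor, sliceTensor, map_blockUnipotent]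
  simp only [map_diagPencil, map_affinePoint]
  rfl

lemma polyMap_diagTensor (e : Fin m × Fin q ≃ Fin n) :
    polyMap (diagTensor e (X : DiagParam m q → MvPolynomial (DiagParam m q) ℂ)) =
      diagTensor e := by
  ext y s
  rw [polyMap, map_diagTensor]
  simp only [eval_X]

lemma polyMap_networkTensor (e : Fin m × Fin q ≃ Fin n) :
    polyMap (networkTensor e (X : NetworkParam m q → MvPolynomial (NetworkParam m q) ℂ)) =
      networkTensor e := by
  ext y s
  rw [polyMap, map_networkTensor]
  simp only [eval_X]

lemma polyMap_sliceTensor (e : Fin m × Fin q ≃ Fin n) :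
    polyMap (sliceTensor e (X : SliceParam m q → MvPolynomial (SliceParam m q) ℂ)) =
      sliceTensor e := by
  ext y s
  rw [polyMap, map_sliceTensor]
  simp only [eval_X]

lemma pencilTensor_mem_range_diagTensor (e : Fin m × Fin q ≃ Fin n)
    (U : Matrix (Fin m × Fin q) (Fin m × Fin q) ℂ) (z : Fin m × Fin 2 → ℂ)
    (V : Matrix (Fin m × Fin q) (Fin m × Fin q) ℂ) :
    pencilTensor e U (diagPencil q z) V ∈ Set.range (diagTensor (A := ℂ) e) :=
  ⟨Sum.elim z (Sum.elim (fun p => U p.1 p.2) fun p => V p.1 p.2), rfl⟩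

lemma range_sliceTensor_subset (e : Fin m × Fin q ≃ Fin n) :
    Set.range (sliceTensor (A := ℂ) e) ⊆ Set.range (diagTensor (A := ℂ) e) := by
  rintro _ ⟨y, rfl⟩
  exact pencilTensor_mem_range_diagTensor e _ _ _

lemma pencilTensor_congr {A : Type*} [CommRing A] (e : Fin m × Fin q ≃ Fin n)
    {X X' Y Y' : Matrix (Fin m × Fin q) (Fin m × Fin q) A}
    {W W' : Fin 2 → Matrix (Fin m × Fin q) (Fin m × Fin q) A}
    (h : ∀ a, X * W a * Y = X' * W' a * Y') : pencilTensor e X W Y = pencilTensor e X' W' Y' := by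
  ext s
  rw [pencilTensor, pencilTensor, h]

/-- The generic tensor `X diag(zᵢ) Y` can be normalized. -/
lemma range_diagTensor_subset (e : Fin m × Fin q ≃ Fin n) :
    Set.range (diagTensor (A := ℂ) e) ⊆ zariskiClosure (Set.range (sliceTensor (A := ℂ) e)) := by
  rintro _ ⟨y, rfl⟩
  let Xg : Matrix (Fin m × Fin q) (Fin m × Fin q) (MvPolynomial (DiagParam m q) ℂ) :=
    Matrix.of fun b c => X (.inr (.inl (b, c)))
  have heval : ∀ y : DiagParam m q → ℂ, eval y (diagBlocks Xg).det =
      (diagBlocks (Matrix.of fun b c => y (.inr (.inl (b, c))))).det := by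
    intro y
    rw [RingHom.map_det]
    congr 1
    ext b c
    simp only [RingHom.mapMatrix_apply, Matrix.map_apply, diagBlocks, Matrix.of_apply, Xg]
    split_ifs <;> simp
  let h : MvPolynomial (DiagParam m q) ℂ := (∏ i, X (.inl (i, 0))) * (diagBlocks Xg).det
  have h0 : h ≠ 0 := by
    intro hh
    have := congrArg (eval (Sum.elim (fun _ => 1) (Sum.elim
      (fun p => (1 : Matrix (Fin m × Fin q) (Fin m × Fin q) ℂ) p.1 p.2) fun _ => 0) :
      DiagParam m q → ℂ)) hh
    rw [map_mul, heval, map_zero, map_prod] at this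
    have h1 : diagBlocks (1 : Matrix (Fin m × Fin q) (Fin m × Fin q) ℂ) = 1 := by
      ext b c
      by_cases hbc : b = c <;> simp [diagBlocks, Matrix.one_apply, hbc]
    simp only [eval_X, Sum.elim_inl, Sum.elim_inr, Finset.prod_const_one, one_mul] at this
    change (diagBlocks (1 : Matrix (Fin m × Fin q) (Fin m × Fin q) ℂ)).det = 0 at this
    rw [h1, Matrix.det_one] at this
    exact one_ne_zero this
  rw [← polyMap_diagTensor]
  refine polyMap_mem_zariskiClosure _ h0 (fun y hy => subset_zariskiClosure _ ?_) y
  rw [polyMap_diagTensor]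
  rw [map_mul, heval, map_prod] at hy
  have hz : ∀ i, y (.inl (i, 0)) ≠ 0 := by
    intro i
    have := Finset.prod_ne_zero_iff.mp (left_ne_zero_of_mul hy) i (Finset.mem_univ i)
    simpa using this
  obtain ⟨N, hN⟩ := exists_blockUnipotent_mul _ (right_ne_zero_of_mul hy)
  set U : Matrix (Fin m × Fin q) (Fin m × Fin q) ℂ :=
    Matrix.of fun b c => y (.inr (.inl (b, c)))
  set V : Matrix (Fin m × Fin q) (Fin m × Fin q) ℂ :=
    Matrix.of fun b c => y (.inr (.inr (b, c)))
  -- The diagonal blocks of `U` and the first coordinates of the `zᵢ` commute past the pencil and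
  -- are absorbed into the right factor.
  let V' := diagBlocks U * diagPencil q (fun p => y (.inl p)) 0 * V
  refine ⟨Sum.elim N (Sum.elim (fun i => (y (.inl (i, 0)))⁻¹ * y (.inl (i, 1)))
    fun p => V' p.1 p.2), ?_⟩
  refine pencilTensor_congr e fun a => ?_
  change blockUnipotent N * diagPencil q (affinePoint fun i =>
    (y (.inl (i, 0)))⁻¹ * y (.inl (i, 1))) a * V' = U * diagPencil q (fun p => y (.inl p)) a * V
  have hc : diagPencil q (fun p => y (.inl p)) a = diagPencil q (affinePoint fun i =>
      (y (.inl (i, 0)))⁻¹ * y (.inl (i, 1))) a * diagPencil q (fun p => y (.inl p)) 0 := by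
    rw [diagPencil, diagPencil, diagPencil, Matrix.diagonal_mul_diagonal]
    congr 1
    ext b
    fin_cases a
    · simp [affinePoint]
    · have := hz b.1
      simp only [affinePoint]
      simp only [Fin.mk_one, one_ne_zero, if_false]
      field_simp
  have hcomm := diagBlocks_commute U fun i => affinePoint (fun i =>
      (y (.inl (i, 0)))⁻¹ * y (.inl (i, 1))) (i, a)
  rw [hc]
  conv_rhs => rw [hN]
  simp only [V', ← mul_assoc]
  congr 2
  rw [mul_assoc, mul_assoc]
  congr 1
  exact hcomm.symm

end Parametrizations

/-! ### Network tensors as pencils `X (Z ⊠ I) Y`, and generic diagonalizability. -/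

section Network

variable {m q n : ℕ}

/-- The condition that the characteristic polynomial of a matrix is separable is given by a
polynomial in the entries. -/
lemma separable_iff_resultant (M : Matrix (Fin m) (Fin m) ℂ) :
    Polynomial.resultant M.charpoly (Polynomial.derivative M.charpoly) m (m - 1) ≠ 0 ↔
      M.charpoly.Separable := by
  have h1 : M.charpoly.natDegree = m := by simp [M.charpoly_natDegree_eq_dim]
  have h2 : (Polynomial.derivative M.charpoly).natDegree = m - 1 := by
    rw [Polynomial.natDegree_derivative, h1]
  have h3 := Polynomial.resultant_eq_zero_iff (f := M.charpoly)
    (g := Polynomial.derivative M.charpoly)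
  rw [h1, h2] at h3
  rw [Ne, h3, Polynomial.Separable]
  simp [M.charpoly_monic.ne_zero]

lemma separable_charpoly_diagonal {d : Fin m → ℂ} (hd : Function.Injective d) :
    (Matrix.diagonal d).charpoly.Separable := by
  rw [Matrix.charpoly_diagonal]
  exact Polynomial.separable_prod_X_sub_C_iff.mpr hd

/-- The generic tensor `X (Z ⊠ I) Y` has diagonalizable `Z`. -/
lemma range_networkTensor_subset (e : Fin m × Fin q ≃ Fin n) :
    Set.range (networkTensor (A := ℂ) e) ⊆ zariskiClosure (Set.range (diagTensor (A := ℂ) e)) := by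
  rintro _ ⟨y, rfl⟩
  let Zg : Fin 2 → Matrix (Fin m) (Fin m) (MvPolynomial (NetworkParam m q) ℂ) :=
    fun a => Matrix.of fun i k => X (.inl (a, i, k))
  let Z : (NetworkParam m q → ℂ) → Fin 2 → Matrix (Fin m) (Fin m) ℂ :=
    fun y a => Matrix.of fun i k => y (.inl (a, i, k))
  have hZ : ∀ y a, (Zg a).map (eval y) = Z y a := by
    intro y a
    ext i k
    simp [Zg, Z]
  let C := (Zg 0).adjugate * Zg 1
  have hC : ∀ y, C.map (eval y) = (Z y 0).adjugate * Z y 1 := by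
    intro y
    rw [Matrix.map_mul, hZ, ← hZ y 0]
    congr 1
    exact RingHom.map_adjugate (eval y) (Zg 0)
  -- Fixing the formal degrees `m` and `m - 1` makes the resultant commute with evaluation.
  let h := (Zg 0).det *
    Polynomial.resultant C.charpoly (Polynomial.derivative C.charpoly) m (m - 1)
  have heval : ∀ y, eval y h = (Z y 0).det * Polynomial.resultant
      ((Z y 0).adjugate * Z y 1).charpoly
      (Polynomial.derivative ((Z y 0).adjugate * Z y 1).charpoly) m (m - 1) := by
    intro y
    rw [map_mul, RingHom.map_det, ← Polynomial.resultant_map_map, ← Polynomial.derivative_map,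
      ← Matrix.charpoly_map, hC, RingHom.mapMatrix_apply, hZ]
  have h0 : h ≠ 0 := by
    intro hh
    -- The witness is `Z₀ = 1`, `Z₁ = diag(0, …, m-1)`, with distinct eigenvalues.
    let y₀ : NetworkParam m q → ℂ := Sum.elim (fun p => if p.1 = 0
      then (1 : Matrix (Fin m) (Fin m) ℂ) p.2.1 p.2.2
      else Matrix.diagonal (fun i : Fin m => (i : ℂ)) p.2.1 p.2.2) fun _ => 0
    have h1 := heval y₀
    have hz0 : Z y₀ 0 = 1 := by
      ext i k
      simp [Z, y₀]
    have hz1 : Z y₀ 1 = Matrix.diagonal (fun i : Fin m => (i : ℂ)) := by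
      ext i k
      simp [Z, y₀]
    rw [hh, map_zero, hz0, hz1, Matrix.det_one, one_mul, Matrix.adjugate_one, one_mul] at h1
    refine (separable_iff_resultant _).mpr (separable_charpoly_diagonal ?_) h1.symm
    intro i j hij
    exact Fin.ext (Nat.cast_injective hij)
  rw [← polyMap_networkTensor]
  refine polyMap_mem_zariskiClosure _ h0 (fun y hy => subset_zariskiClosure _ ?_) y
  rw [polyMap_networkTensor]
  rw [heval] at hy
  obtain ⟨U, V, μ, hU, hV⟩ := exists_diagonalization_pencil (Z y 0) (Z y 1)
    (left_ne_zero_of_mul hy) ((separable_iff_resultant _).mp (right_ne_zero_of_mul hy))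
  have hW : ∀ a, Z y a ⊗ₖ (1 : Matrix (Fin q) (Fin q) ℂ) =
      U ⊗ₖ (1 : Matrix (Fin q) (Fin q) ℂ) * diagPencil q (affinePoint μ) a *
        V ⊗ₖ (1 : Matrix (Fin q) (Fin q) ℂ) := by
    intro a
    fin_cases a
    · change Z y 0 ⊗ₖ _ = _ * diagPencil q (affinePoint μ) 0 * _
      rw [diagPencil_affinePoint_zero, mul_one, ← Matrix.mul_kronecker_mul, one_mul, ← hU]
    · change Z y 1 ⊗ₖ _ = _ * diagPencil q (affinePoint μ) 1 * _
      have : Matrix.diagonal (fun b : Fin m × Fin q => μ b.1) =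
          Matrix.diagonal μ ⊗ₖ (1 : Matrix (Fin q) (Fin q) ℂ) := by
        rw [← Matrix.diagonal_one, Matrix.diagonal_kronecker_diagonal]
        simp
      rw [diagPencil_affinePoint_one, this, ← Matrix.mul_kronecker_mul, ← Matrix.mul_kronecker_mul,
        one_mul, one_mul, ← hV]
  have : networkTensor e y = pencilTensor e
      (Matrix.of (fun b c => y (.inr (.inl (b, c)))) * U ⊗ₖ (1 : Matrix (Fin q) (Fin q) ℂ))
      (diagPencil q (affinePoint μ))
      (V ⊗ₖ (1 : Matrix (Fin q) (Fin q) ℂ) * Matrix.of fun b c => y (.inr (.inr (b, c)))) := by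
    refine pencilTensor_congr e fun a => ?_
    have := hW a
    simp only [Z] at this
    rw [this]
    simp only [mul_assoc]
  rw [this]
  exact pencilTensor_mem_range_diagTensor e _ _ _

/-- The tensors of the triangle network in terms of pencils. -/
lemma triangleMap_eq (e : Fin m × Fin q ≃ Fin n) (X0 : Matrix (Fin 2) (Fin m × Fin m) ℂ)
    (X1 : Matrix (Fin n) (Fin m × Fin q) ℂ) (X2 : Matrix (Fin n) (Fin q × Fin m) ℂ) :
    triangleMap m q m 2 n n X0 X1 X2 = pencilTensor e (Matrix.of fun b c => X1 (e b) c)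
      (fun a => (Matrix.of fun i k => X0 a (i, k)) ⊗ₖ (1 : Matrix (Fin q) (Fin q) ℂ))
      (Matrix.of fun b c => X2 (e c) (b.2, b.1)) := by
  ext ⟨a, s, t⟩
  have h1 : ∀ w0 : Fin m × Fin m, (∑ w1 : Fin m × Fin q, ∑ w2 : Fin q × Fin m,
      X0 a w0 * X1 s w1 * X2 t w2 * graphTensor m q m w0 w1 w2) =
      ∑ j, X0 a w0 * X1 s (w0.1, j) * X2 t (j, w0.2) := by
    intro w0
    simp only [graphTensor, Fintype.sum_prod_type, mul_ite, mul_one, mul_zero,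
      Finset.sum_ite_eq, Finset.mem_univ, if_true]
    rw [Finset.sum_comm]
    simp
  have h2 : ∀ b : Fin m × Fin q, (∑ c : Fin m × Fin q, X1 s c *
      (X0 a (c.1, b.1) * (1 : Matrix (Fin q) (Fin q) ℂ) c.2 b.2)) =
      ∑ i, X1 s (i, b.2) * X0 a (i, b.1) := by
    intro b
    simp [Fintype.sum_prod_type, Matrix.one_apply]
  simp only [triangleMap, h1, pencilTensor, Matrix.mul_apply, Matrix.of_apply,
    Matrix.kroneckerMap_apply, Equiv.apply_symm_apply, h2]
  rw [Fintype.sum_prod_type, Fintype.sum_prod_type, Finset.sum_comm]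
  refine Finset.sum_congr rfl fun k _ => ?_
  rw [Finset.sum_comm]
  refine Finset.sum_congr rfl fun j _ => ?_
  rw [Finset.sum_mul]
  exact Finset.sum_congr rfl fun i _ => by ring

end Network

/-! ### The variety as a closure of diagonal tensors, and its generic element. -/

section Variety

variable {m q n : ℕ}

lemma range_diagTensor_subset_triangle (e : Fin m × Fin q ≃ Fin n) :
    Set.range (diagTensor (A := ℂ) e) ⊆
      {T | ∃ X0 X1 X2, T = triangleMap m q m 2 n n X0 X1 X2} := by
  rintro _ ⟨y, rfl⟩
  refine ⟨Matrix.of fun a p => Matrix.diagonal (fun i => y (.inl (i, a))) p.1 p.2,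
    Matrix.of fun s c => y (.inr (.inl (e.symm s, c))),
    Matrix.of fun t c => y (.inr (.inr ((c.2, c.1), e.symm t))), ?_⟩
  rw [triangleMap_eq e]
  refine pencilTensor_congr e fun a => ?_
  simp only [Matrix.of_apply, Equiv.symm_apply_apply]
  congr 2
  change _ = Matrix.diagonal (fun i => y (.inl (i, a))) ⊗ₖ (1 : Matrix (Fin q) (Fin q) ℂ)
  rw [← Matrix.diagonal_one, Matrix.diagonal_kronecker_diagonal, diagPencil]
  simp

lemma triangle_subset_range_networkTensor (e : Fin m × Fin q ≃ Fin n) :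
    {T | ∃ X0 X1 X2, T = triangleMap m q m 2 n n X0 X1 X2} ⊆
      Set.range (networkTensor (A := ℂ) e) := by
  rintro _ ⟨X0, X1, X2, rfl⟩
  rw [triangleMap_eq e]
  exact ⟨Sum.elim (fun p => X0 p.1 (p.2.1, p.2.2)) (Sum.elim (fun p => X1 (e p.1) p.2)
    fun p => X2 (e p.2) (p.1.2, p.1.1)), rfl⟩

/-- The set of network tensors contains the diagonal tensors and lies in their closure. -/
lemma triangleTNS_eq_closure_range_diagTensor (e : Fin m × Fin q ≃ Fin n) :
    triangleTNS m q m 2 n n = zariskiClosure (Set.range (diagTensor (A := ℂ) e)) := by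
  apply Set.Subset.antisymm
  · exact zariskiClosure_subset_of_subset ((triangle_subset_range_networkTensor e).trans
      (range_networkTensor_subset e))
  · exact zariskiClosure_subset_of_subset ((range_diagTensor_subset_triangle e).trans
      (subset_zariskiClosure _))

lemma triangleTNS_eq_closure_range_sliceTensor (e : Fin m × Fin q ≃ Fin n) :
    triangleTNS m q m 2 n n = zariskiClosure (Set.range (sliceTensor (A := ℂ) e)) := by
  rw [triangleTNS_eq_closure_range_diagTensor e]
  apply Set.Subset.antisymm
  · exact zariskiClosure_subset_of_subset (range_diagTensor_subset e)
  · exact zariskiClosure_subset_of_subset ((range_sliceTensor_subset e).trans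
      (subset_zariskiClosure _))

/-- The re-indexing of the rows and columns of the normal form. -/
def normalFormEquiv (m q : ℕ) : ((_ : Fin m) × (Fin 1 × Fin q)) ≃ Fin m × Fin q :=
  (Equiv.sigmaEquivProd (Fin m) (Fin 1 × Fin q)).trans
    (Equiv.prodCongr (Equiv.refl _) (Equiv.uniqueProd (Fin q) (Fin 1)))

lemma normalForm_eq (z : Fin m × Fin 2 → ℂ) (a : Fin 2) :
    normalForm m q z a =
      (diagPencil q z a).submatrix (normalFormEquiv m q) (normalFormEquiv m q) := by
  ext ⟨i, u, j⟩ ⟨i', u', j'⟩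
  obtain rfl : u = 0 := Subsingleton.elim _ _
  obtain rfl : u' = 0 := Subsingleton.elim _ _
  by_cases hi : i = i'
  · subst hi
    by_cases hj : j = j' <;>
    simp [normalForm, blockSum, kroneckerProd, jordanPencil, diagPencil, normalFormEquiv,
      Matrix.blockDiagonal'_apply, hj]
  · simp [normalForm, blockSum, diagPencil, normalFormEquiv, Matrix.blockDiagonal'_apply, hi]

/-- Tensors equivalent to a normal form lie in the image of the diagonal parametrization. -/
lemma mem_range_diagTensor_of_pencilEquiv (e : Fin m × Fin q ≃ Fin n) (z : Fin m × Fin 2 → ℂ)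
    {T : TensorSpace 2 n n} (h : PencilEquiv (toPencil T) (normalForm m q z)) :
    T ∈ Set.range (diagTensor (A := ℂ) e) := by
  obtain ⟨g1, g2, hg⟩ := h
  let f := normalFormEquiv m q
  set G1 := LinearMap.toMatrix' (g1 : ((_ : Fin m) × (Fin 1 × Fin q) → ℂ) →ₗ[ℂ] (Fin n → ℂ))
  set G2 := LinearMap.toMatrix' (g2 : ((_ : Fin m) × (Fin 1 × Fin q) → ℂ) →ₗ[ℂ] (Fin n → ℂ))
  have : T = pencilTensor e (G1.submatrix e f.symm) (diagPencil q z)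
      (G2.transpose.submatrix f.symm e) := by
    ext ⟨a, s, t⟩
    have h1 := congrFun (congrFun (hg a) s) t
    have h2 : diagPencil q z a = (normalForm m q z a).submatrix f.symm f.symm := by
      rw [normalForm_eq]
      simp [f]
    rw [pencilTensor, h2, Matrix.submatrix_mul_equiv, Matrix.submatrix_mul_equiv]
    simpa [toPencil] using h1
  rw [this]
  exact pencilTensor_mem_range_diagTensor e _ _ _

/-- An invertible matrix with relabelled rows and columns is the matrix of an isomorphism. -/
lemma exists_linearEquiv_toMatrix' {I J B : Type} [Fintype I] [DecidableEq I] [Fintype J]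
    [DecidableEq J] [Fintype B] [DecidableEq B] (M : Matrix B B ℂ) (hM : IsUnit M.det)
    (e : I ≃ B) (f : J ≃ B) :
    ∃ g : (J → ℂ) ≃ₗ[ℂ] (I → ℂ),
      LinearMap.toMatrix' (g : (J → ℂ) →ₗ[ℂ] (I → ℂ)) = M.submatrix e f := by
  refine ⟨Matrix.toLin'OfInv (M := M⁻¹.submatrix f e) (M' := M.submatrix e f) ?_ ?_, ?_⟩
  · rw [Matrix.submatrix_mul_equiv, Matrix.nonsing_inv_mul _ hM, Matrix.submatrix_one_equiv]
  · rw [Matrix.submatrix_mul_equiv, Matrix.mul_nonsing_inv _ hM, Matrix.submatrix_one_equiv]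
  · exact LinearMap.toMatrix'_toLin' _

lemma pencilEquiv_pencilTensor (e : Fin m × Fin q ≃ Fin n)
    {U V : Matrix (Fin m × Fin q) (Fin m × Fin q) ℂ} (hU : IsUnit U.det) (hV : IsUnit V.det)
    (z : Fin m × Fin 2 → ℂ) :
    PencilEquiv (toPencil (pencilTensor e U (diagPencil q z) V)) (normalForm m q z) := by
  obtain ⟨g1, hg1⟩ := exists_linearEquiv_toMatrix' U hU e.symm (normalFormEquiv m q)
  obtain ⟨g2, hg2⟩ := exists_linearEquiv_toMatrix' V.transpose
    (by rwa [Matrix.det_transpose]) e.symm (normalFormEquiv m q)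
  refine ⟨g1, g2, fun a => ?_⟩
  rw [hg1, hg2, normalForm_eq, Matrix.submatrix_mul_equiv, Matrix.transpose_submatrix,
    Matrix.transpose_transpose, Matrix.submatrix_mul_equiv]
  rfl

/-- The good parameters are those with `det U`, `det V` and `g(z)` non-zero, an open condition to
which Chevalley's theorem applies. -/
lemma holdsGenerically_normalForm (e : Fin m × Fin q ≃ Fin n) {Ω : Set (Fin m × Fin 2 → ℂ)}
    (hΩ : IsZariskiOpen Ω) (hne : Ω.Nonempty) :
    HoldsGenerically (triangleTNS m q m 2 n n)
      (fun T => ∃ z ∈ Ω, PencilEquiv (toPencil T) (normalForm m q z)) := by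
  obtain ⟨g, hg, hgΩ⟩ := hΩ.exists_polynomial hne
  rw [triangleTNS_eq_closure_range_diagTensor e, ← polyMap_diagTensor]
  let U : Matrix (Fin m × Fin q) (Fin m × Fin q) (MvPolynomial (DiagParam m q) ℂ) :=
    Matrix.of fun b c => X (.inr (.inl (b, c)))
  let V : Matrix (Fin m × Fin q) (Fin m × Fin q) (MvPolynomial (DiagParam m q) ℂ) :=
    Matrix.of fun b c => X (.inr (.inr (b, c)))
  have hU : ∀ y, eval y U.det = (Matrix.of fun b c => y (.inr (.inl (b, c)))).det := by
    intro y
    rw [RingHom.map_det]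
    congr 1
    ext b c
    simp [U]
  have hV : ∀ y, eval y V.det = (Matrix.of fun b c => y (.inr (.inr (b, c)))).det := by
    intro y
    rw [RingHom.map_det]
    congr 1
    ext b c
    simp [V]
  have hone : (1 : Matrix (Fin m × Fin q) (Fin m × Fin q) ℂ) = Matrix.of fun b c =>
      (1 : Matrix (Fin m × Fin q) (Fin m × Fin q) ℂ) b c := rfl
  have hU0 : U.det ≠ 0 := by
    intro h
    have := hU fun t => Sum.elim (fun _ => 0) (Sum.elim
      (fun p => (1 : Matrix (Fin m × Fin q) (Fin m × Fin q) ℂ) p.1 p.2) fun _ => 0) t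
    simp only [h, map_zero, Sum.elim_inl, Sum.elim_inr, ← hone, Matrix.det_one] at this
    exact zero_ne_one this
  have hV0 : V.det ≠ 0 := by
    intro h
    have := hV fun t => Sum.elim (fun _ => 0) (Sum.elim (fun _ => 0)
      (fun p => (1 : Matrix (Fin m × Fin q) (Fin m × Fin q) ℂ) p.1 p.2)) t
    simp only [h, map_zero, Sum.elim_inr, ← hone, Matrix.det_one] at this
    exact zero_ne_one this
  have hg0 : rename Sum.inl g ≠ (0 : MvPolynomial (DiagParam m q) ℂ) := by
    rw [Ne, map_eq_zero_iff _ (rename_injective _ Sum.inl_injective)]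
    exact hg
  refine holdsGenerically_of_polyMap _ (mul_ne_zero (mul_ne_zero hU0 hV0) hg0) fun y hy => ?_
  rw [map_mul, map_mul, hU, hV, eval_rename] at hy
  refine ⟨y ∘ Sum.inl, hgΩ _ (right_ne_zero_of_mul hy), ?_⟩
  rw [polyMap_diagTensor]
  exact pencilEquiv_pencilTensor e (left_ne_zero_of_mul (left_ne_zero_of_mul hy)).isUnit
    (right_ne_zero_of_mul (left_ne_zero_of_mul hy)).isUnit _

end Variety

/-! ### The dimension and the defects. -/

section TriangleDimension

variable {m q n : ℕ}

lemma card_sliceParam (m q : ℕ) (hm : 1 ≤ m) :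
    Fintype.card (SliceParam m q) = (2 * m - 1) * m * q ^ 2 + m := by
  let f : {p : (Fin m × Fin q) × (Fin m × Fin q) // p.1.1 = p.2.1} ≃ Fin m × Fin q × Fin q :=
    { toFun := fun p => (p.1.1.1, p.1.1.2, p.1.2.2)
      invFun := fun p => ⟨((p.1, p.2.1), (p.1, p.2.2)), rfl⟩
      left_inv := by
        rintro ⟨⟨⟨i, j⟩, ⟨i', j'⟩⟩, h⟩
        obtain rfl : i = i' := h
        rfl
      right_inv := fun p => rfl }
  have h1 := Fintype.card_subtype_compl (fun p : (Fin m × Fin q) × (Fin m × Fin q) => p.1.1 = p.2.1)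
  have h2 := Fintype.card_subtype_le
    (fun p : (Fin m × Fin q) × (Fin m × Fin q) => p.1.1 = p.2.1)
  rw [Fintype.card_congr f] at h1 h2
  simp only [Fintype.card_prod, Fintype.card_fin] at h1 h2
  simp only [Fintype.card_sum, Fintype.card_prod, Fintype.card_fin]
  rw [h1]
  zify [h2, (by omega : 1 ≤ 2 * m)]
  ring

/-- The dimension of the triangle tensor network variety. -/
lemma affineDim_triangleTNS [NeZero q] (hm : 1 ≤ m) (e : Fin m × Fin q ≃ Fin n) :
    affineDim (triangleTNS m q m 2 n n) = (((2 * m - 1) * m * q ^ 2 + m : ℕ) : WithBot ℕ∞) := by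
  rw [triangleTNS_eq_closure_range_sliceTensor e, ← polyMap_sliceTensor, ← card_sliceParam m q hm]
  refine affineDim_closure_range_polyMap _ fun D hD t => ?_
  set R := MvPolynomial (SliceParam m q) ℂ
  set K := FractionRing R
  let v : SliceParam m q → K := fun t => algebraMap R K (X t)
  let U : Matrix (Fin m × Fin q) (Fin m × Fin q) K := blockUnipotent fun p => v (.inl p)
  let μ : Fin m → K := fun i => v (.inr (.inl i))
  let V : Matrix (Fin m × Fin q) (Fin m × Fin q) K := Matrix.of fun b c => v (.inr (.inr (b, c)))
  have hinj : Function.Injective (algebraMap R K) := IsFractionRing.injective R K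
  have hone : (1 : Matrix (Fin m × Fin q) (Fin m × Fin q) ℂ) = Matrix.of fun b c =>
      (1 : Matrix (Fin m × Fin q) (Fin m × Fin q) ℂ) b c := rfl
  -- At this point `U = V = 1`, so neither generic determinant is the zero polynomial.
  let y₀ : SliceParam m q → ℂ := Sum.elim (fun _ => 0) (Sum.elim (fun _ => 0)
    fun p => (1 : Matrix (Fin m × Fin q) (Fin m × Fin q) ℂ) p.1 p.2)
  have hU : U.det ≠ 0 := by
    let Ug : Matrix (Fin m × Fin q) (Fin m × Fin q) R := blockUnipotent fun p => X (.inl p)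
    have h1 : U = (algebraMap R K).mapMatrix Ug :=
      (map_blockUnipotent (algebraMap R K) fun p => X (.inl p)).symm
    rw [h1, ← RingHom.map_det, Ne, map_eq_zero_iff _ hinj]
    intro h
    have h2 := congrArg (eval y₀) h
    rw [map_zero, RingHom.map_det, RingHom.mapMatrix_apply, map_blockUnipotent] at h2
    simp only [eval_X, y₀, Sum.elim_inl, blockUnipotent_zero, Matrix.det_one] at h2
    exact one_ne_zero h2
  have hV : V.det ≠ 0 := by
    let Vg : Matrix (Fin m × Fin q) (Fin m × Fin q) R :=
      Matrix.of fun b c => X (.inr (.inr (b, c)))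
    have h1 : V = (algebraMap R K).mapMatrix Vg := rfl
    rw [h1, ← RingHom.map_det, Ne, map_eq_zero_iff _ hinj]
    intro h
    have h2 := congrArg (eval y₀) h
    have h3 : Vg.map (eval y₀) = 1 := by
      ext b c
      simp [Vg, y₀]
    rw [map_zero, RingHom.map_det, RingHom.mapMatrix_apply, h3, Matrix.det_one] at h2
    exact one_ne_zero h2
  have hμ : Function.Injective μ := fun i j hij =>
    Sum.inl_injective (Sum.inr_injective (X_injective (hinj hij)))
  have hF : ∀ s, D (sliceTensor e v s) = 0 := by
    intro s
    rw [← map_sliceTensor]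
    exact hD s
  have hmat : ∀ a, (U * diagPencil q (affinePoint μ) a * V).map D = 0 := by
    intro a
    ext b c
    have := hF (a, e b, e c)
    rw [sliceTensor, pencilTensor] at this
    simp only [Equiv.symm_apply_apply] at this
    exact this
  have h0 := hmat 0
  have h1 := hmat 1
  rw [diagPencil_affinePoint_zero, mul_one] at h0
  rw [diagPencil_affinePoint_one] at h1
  obtain ⟨hDU, hDμ, hDV⟩ := derivation_eq_zero_of_pencil D hU hV hμ
    (fun b c h => blockUnipotent_apply_of_eq _ h) h0 h1
  rcases t with ⟨⟨b, c⟩, h⟩ | i | ⟨b, c⟩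
  · have := congrFun (congrFun hDU b) c
    simpa [U, blockUnipotent, h] using this
  · exact hDμ i
  · exact congrFun (congrFun hDV b) c

lemma affineDimInt_triangleTNS [NeZero q] (hm : 1 ≤ m) (e : Fin m × Fin q ≃ Fin n) :
    affineDimInt (triangleTNS m q m 2 n n) = (2 * (m : ℤ) - 1) * m * q ^ 2 + m := by
  rw [affineDimInt, affineDim_triangleTNS hm e]
  have : ((((2 * m - 1) * m * q ^ 2 + m : ℕ) : WithBot ℕ∞).unbotD 0).toNat =
    (2 * m - 1) * m * q ^ 2 + m := rfl
  rw [this]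
  zify [(by omega : 1 ≤ 2 * m)]

lemma triangleFiberDefect_eq [NeZero q] (hm : 1 ≤ m) (e : Fin m × Fin q ≃ Fin (q * m)) :
    triangleFiberDefect m q m 2 (q * m) (q * m) = ((m : ℤ) - 1) * ((q : ℤ) ^ 2 - 1) := by
  rw [triangleFiberDefect, affineDimInt_triangleTNS hm e, triangleParamCount]
  push_cast
  ring

/-- With `n = q m` the count equals `2 n² - (q² - 1)`, so the minimum in the expected dimension is
the count and the two defects agree. -/
lemma triangleParamCount_le [NeZero q] :
    triangleParamCount m q m 2 (q * m) (q * m) ≤ ((2 : ℕ) : ℤ) * (q * m : ℕ) * (q * m : ℕ) := by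
  have hq : (1 : ℤ) ≤ q := by exact_mod_cast NeZero.one_le
  rw [triangleParamCount]
  push_cast
  nlinarith

end TriangleDimension

end TensorNetwork

end

theorem mainTheorem3 (m m12 : ℕ) (hm : 1 ≤ m) (hm12 : 1 ≤ m12) :
    (∀ Ω : Set (Fin m × Fin 2 → ℂ), TensorNetwork.IsZariskiOpen Ω → Ω.Nonempty →
      TensorNetwork.HoldsGenerically
        (TensorNetwork.triangleTNS m m12 m 2 (m12 * m) (m12 * m))
        (fun T => ∃ z ∈ Ω,
          TensorNetwork.PencilEquiv (TensorNetwork.toPencil T)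
            (TensorNetwork.normalForm m m12 z))) ∧
    (∀ (z : Fin m × Fin 2 → ℂ) (T : TensorNetwork.TensorSpace 2 (m12 * m) (m12 * m)),
      TensorNetwork.PencilEquiv (TensorNetwork.toPencil T) (TensorNetwork.normalForm m m12 z) →
        T ∈ TensorNetwork.triangleTNS m m12 m 2 (m12 * m) (m12 * m)) ∧
    TensorNetwork.affineDim (TensorNetwork.triangleTNS m m12 m 2 (m12 * m) (m12 * m)) =
      (((2 * m - 1) * m * m12 ^ 2 + m : ℕ) : WithBot ℕ∞) ∧
    TensorNetwork.triangleDefect m m12 m 2 (m12 * m) (m12 * m) =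
      ((m : ℤ) - 1) * ((m12 : ℤ) ^ 2 - 1) ∧
    TensorNetwork.triangleFiberDefect m m12 m 2 (m12 * m) (m12 * m) =
      ((m : ℤ) - 1) * ((m12 : ℤ) ^ 2 - 1) := by
  have : NeZero m12 := ⟨by omega⟩
  let e : Fin m × Fin m12 ≃ Fin (m12 * m) := (Equiv.prodComm _ _).trans finProdFinEquiv
  refine ⟨fun Ω hΩ hne => TensorNetwork.holdsGenerically_normalForm e hΩ hne, fun z T h => ?_,
    TensorNetwork.affineDim_triangleTNS hm e, ?_, TensorNetwork.triangleFiberDefect_eq hm e⟩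
  · rw [TensorNetwork.triangleTNS_eq_closure_range_diagTensor e]
    exact TensorNetwork.subset_zariskiClosure _
      (TensorNetwork.mem_range_diagTensor_of_pencilEquiv e z h)
  · rw [TensorNetwork.triangleDefect, TensorNetwork.triangleExpDim,
      min_eq_left TensorNetwork.triangleParamCount_le]
    exact TensorNetwork.triangleFiberDefect_eq hm e
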